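/- Let $g\in\mathbb{Q}[x,y]$ be square-free (a nonconstant product of pairwise non-associate irreducible polynomials, up to a nonzero rational factor) with $\deg(g,y)\ge 1$. Write $\operatorname{lc}(g,x)\in\mathbb{Q}[y]$ and $\operatorname{lc}(g,y)\in\mathbb{Q}[x]$ for the leading coefficients of $g$ with respect to $x$ and $y$, and $\operatorname{discrim}(g,y)\in\mathbb{Q}[x]$ for its discriminant with respect to $y$. Let $I=[(a_0,b_0),\dots,(a_{s+1},b_{s+1})]$, $s\ge 0$, be a general potential periodic interval set of $g$, i.e. $a_0=-\infty$, $b_{s+1}=+\infty$, all other endpoints are rational, $b_0<0<a_{s+1}$, and 1. $a_j<b_j$ for $1\le j\le s$ and $b_j\le a_{j+1}$ for $0\le j\le s$; 2. every real root of $\operatorname{lc}(g,x)$ lies in some $(a_j,b_j)$ with $1\le j\le s$; 3. each $(a_j,b_j)$ with $1\le j\le s$ contains at most one real root of $\operatorname{lc}(g,x)$. Algorithm IsolatingFarZero, on input $(g,I)$, does the following. * Find $k'\in\mathbb{N}$ such that $(k'+\tfrac12)\pi$ is an upper bound for all real roots of $\operatorname{lc}(g,y)\cdot\operatorname{discrim}(g,y)\cdot\prod_{j=0}^{s}g(x,b_j)\,g(x,a_{j+1})$.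 * Choose an integer $x_0>(k'+\tfrac12)\pi$. * Set $c_0=\dots=c_{s+1}=0$. For each real root $r$ of $g(x_0,y)$, find the first $j\in\{0,\dots,s+1\}$ with $r\in(a_j,b_j)$, if there is one, and increase $c_j$ by $1$. * Return $k'$ and the set $ret$ of all pairs $((x_j^-,x_j^+),c_j)$ with $c_j>0$, where $x_j^-=\arctan a_j$, $x_j^+=\arctan b_j$ and $\arctan(\pm\infty)=\pm\tfrac{\pi}{2}$. **Theorem.** Algorithm IsolatingFarZero is correct. That is, a number $k'$ as required in the first step exists; for every such $k'$ an integer $x_0$ as required exists; for every such $x_0$ the polynomial $g(x_0,y)$ has only finitely many real roots; and, whatever choices of $k'$ and $x_0$ are made (and in whatever order the roots are visited), for every $k\in\mathbb{N}$ with $k>k'$ and every returned pair $((x_j^-,x_j^+),c_j)$, the interval $(x_j^-+k\pi,\;x_j^++k\pi)$ contains at least $c_j$ distinct real roots of $g(x,\tan x)$. -/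

import Mathlib

open scoped Polynomial.Bivariate

noncomputable section

namespace FarZero

/-! Polynomials in `ℚ[x, y]` are elements of `ℚ[X][Y]`: the outer variable is `y`, the inner one
is `x`.  Thus `deg(g, y) = g.natDegree`, `lc(g, y) = g.leadingCoeff`, `discrim(g, y) = g.discr`
(the last two are elements of `ℚ[x]`). -/

/-- The real number `g(x, y)`. -/
def evalReal (g : ℚ[X][Y]) (x y : ℝ) : ℝ :=
  Polynomial.aevalAeval x y g

/-- `lc(g, x)`: the leading coefficient of `g` with respect to `x`, a polynomial in `y`. -/
def leadCoeffX (g : ℚ[X][Y]) : Polynomial ℚ :=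
  (Polynomial.Bivariate.swap g).leadingCoeff

/-- A list of open intervals `[(a₀, b₀), …, (a_{s+1}, b_{s+1})]` with `a₀ = -∞`,
`b_{s+1} = +∞` and all other endpoints rational.  Only the rational endpoints are stored:
`b i` is `b_i` for `0 ≤ i ≤ s`, and `a i` is `a_{i+1}` for `0 ≤ i ≤ s`. -/
structure IntervalList where
  /-- the number of bounded intervals -/
  s : ℕ
  /-- `a i` is `a_{i+1}` -/
  a : Fin (s + 1) → ℚ
  /-- `b i` is `b_i` -/
  b : Fin (s + 1) → ℚ

/-- The left endpoint `a_j`, `0 ≤ j ≤ s + 1`, with `a₀ = -∞`. -/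
def IntervalList.lower (I : IntervalList) : Fin (I.s + 2) → EReal :=
  Fin.cons ⊥ (fun i => ((I.a i : ℝ) : EReal))

/-- The right endpoint `b_j`, `0 ≤ j ≤ s + 1`, with `b_{s+1} = +∞`. -/
def IntervalList.upper (I : IntervalList) : Fin (I.s + 2) → EReal :=
  Fin.snoc (α := fun _ => EReal) (fun i => ((I.b i : ℝ) : EReal)) ⊤

/-- The set of reals in the open interval `(a_j, b_j)`. -/
def IntervalList.interval (I : IntervalList) (j : Fin (I.s + 2)) : Set ℝ :=
  {r : ℝ | I.lower j < (r : EReal) ∧ (r : EReal) < I.upper j}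

/-- `I` is a general potential periodic interval set of `g`. The bounded intervals `(a_j, b_j)`,
`1 ≤ j ≤ s`, are indexed by `i : Fin s` with `j = i + 1`, so that `a_j` is `I.a i.castSucc` and
`b_j` is `I.b i.succ`. -/
structure IsGeneralPotentialPeriodic (g : ℚ[X][Y]) (I : IntervalList) : Prop where
  /-- `b₀ < 0` -/
  b_zero_neg : I.b 0 < 0
  /-- `a_{s+1} > 0` -/
  a_last_pos : 0 < I.a (Fin.last I.s)
  /-- `a_j < b_j` for `1 ≤ j ≤ s` -/
  a_lt_b : ∀ i : Fin I.s, I.a i.castSucc < I.b i.succ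
  /-- `b_j ≤ a_{j+1}` for `0 ≤ j ≤ s` -/
  b_le_a : ∀ i : Fin (I.s + 1), I.b i ≤ I.a i
  /-- every real root of `lc(g, x)` lies in some `(a_j, b_j)`, `1 ≤ j ≤ s` (and so, the intervals
  being disjoint, none lies in the two unbounded intervals) -/
  root_mem : ∀ r : ℝ, Polynomial.aeval r (leadCoeffX g) = 0 →
    ∃ i : Fin I.s, r ∈ Set.Ioo (I.a i.castSucc : ℝ) (I.b i.succ : ℝ)
  /-- every `(a_j, b_j)`, `1 ≤ j ≤ s`, contains at most one real root of `lc(g, x)` -/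
  root_unique : ∀ i : Fin I.s,
    {r : ℝ | r ∈ Set.Ioo (I.a i.castSucc : ℝ) (I.b i.succ : ℝ) ∧
      Polynomial.aeval r (leadCoeffX g) = 0}.Subsingleton

/-! ### The algorithm `IsolatingFarZero`

Its free choices are the natural number `k'`, the integer `x₀`, and the order in which the real
roots of `g(x₀, y)` are visited. -/

/-- `lc(g, y) · discrim(g, y) · ∏_{j=0}^{s} g(x, b_j) g(x, a_{j+1})`, a polynomial in `x`. -/
def boundPoly (g : ℚ[X][Y]) (I : IntervalList) : Polynomial ℚ :=
  g.leadingCoeff * g.discr *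
    ∏ j : Fin (I.s + 1),
      (g.eval (Polynomial.C (I.b j)) * g.eval (Polynomial.C (I.a j)))

/-- The requirement on `k'`: `(k' + 1/2)π` is an upper bound for all real roots of
`boundPoly g I`. -/
def IsChoiceOfBound (g : ℚ[X][Y]) (I : IntervalList) (k' : ℕ) : Prop :=
  ∀ x : ℝ, Polynomial.aeval x (boundPoly g I) = 0 → x ≤ ((k' : ℝ) + 1 / 2) * Real.pi

/-- The requirement on the sample point: `x₀` is an integer with `x₀ > (k' + 1/2)π`. -/
def IsChoiceOfSample (k' : ℕ) (x₀ : ℤ) : Prop :=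
  ((k' : ℝ) + 1 / 2) * Real.pi < (x₀ : ℝ)

/-- `roots` lists the real roots of `g(x₀, y)`, each exactly once. -/
def ListsRoots (g : ℚ[X][Y]) (x₀ : ℤ) (roots : List ℝ) : Prop :=
  roots.Nodup ∧ ∀ r : ℝ, r ∈ roots ↔ evalReal g (x₀ : ℝ) r = 0

open Classical in
/-- The inner loop for one root `r`: go through `j = 0, …, s + 1`; at the first `j` with
`r ∈ (a_j, b_j)` increase `c_j` by one and break. -/
def countStep (I : IntervalList) (c : Fin (I.s + 2) → ℕ) (r : ℝ) : Fin (I.s + 2) → ℕ :=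
  match (List.finRange (I.s + 2)).find? (fun j => decide (r ∈ I.interval j)) with
  | some j => Function.update c j (c j + 1)
  | none => c

/-- The outer loop over the roots, started with all `c_j = 0`. -/
def counts (I : IntervalList) (roots : List ℝ) : Fin (I.s + 2) → ℕ :=
  roots.foldl (countStep I) (fun _ => 0)

open Classical in
/-- `arctan` on the extended reals, `arctan (±∞) = ±π/2`. -/
def arctanE (t : EReal) : ℝ :=
  if t = ⊥ then -(Real.pi / 2) else if t = ⊤ then Real.pi / 2 else Real.arctan t.toReal

open Classical in
/-- The returned set `ret`: the pairs `((arctan a_j, arctan b_j), c_j)` with `c_j > 0`. -/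
def output (I : IntervalList) (roots : List ℝ) : Finset ((ℝ × ℝ) × ℕ) :=
  (Finset.univ.filter (fun j : Fin (I.s + 2) => 0 < counts I roots j)).image
    (fun j => ((arctanE (I.lower j), arctanE (I.upper j)), counts I roots j))

/-- The real roots of `g(x, tan x)` in the open interval `(u, v)`. -/
def tanRoots (g : ℚ[X][Y]) (u v : ℝ) : Set ℝ :=
  {x : ℝ | x ∈ Set.Ioo u v ∧ Real.cos x ≠ 0 ∧ evalReal g x (Real.tan x) = 0}

/-- The output specification: for every pair `((x⁻, x⁺), c)` in `ret` and every natural number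
`k > k'`, there are at least `c` roots of `g(x, tan x)` in `(x⁻ + kπ, x⁺ + kπ)`. -/
def MeetsSpec (g : ℚ[X][Y]) (k' : ℕ) (ret : Finset ((ℝ × ℝ) × ℕ)) : Prop :=
  ∀ p ∈ ret, ∀ k : ℕ, k' < k →
    (p.2 : ℕ∞) ≤ (tanRoots g (p.1.1 + k * Real.pi) (p.1.2 + k * Real.pi)).encard

end FarZero

end

/-! Put ρ = (k' + 1/2)π. For x ≥ ρ neither lc(g, y) nor discrim(g, y) vanishes, so the real roots of
g(x, ·) stay locally bounded and simple. They move along continuous, pairwise disjoint branches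
(`exists_root_branches`), obtained by lifting paths through the projection of the curve g = 0 to the
x-axis, a covering map. Since g(x, a_j) and g(x, b_j) do not vanish either, no branch crosses a
finite endpoint. A branch that lies in (a_j, b_j) over x₀ therefore stays there, and over the k-th
window, where tan increases from a_j to b_j, it must meet the graph of tan. Disjoint branches give
distinct crossings (`card_le_encard_tanRoots`).

A suitable k' exists because the bounding polynomial is nonzero: squarefreeness handles the
discriminant (`discr_ne_zero`), the position of the endpoints handles the other factors
(`leadCoeffX_root`). The bound by ρ is not strict, and the window k = k' + 1 may start at ρ itself;
a zero there is excluded because π is transcendental (`transcendental_pi`). -/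

noncomputable section

namespace FarZero

/-! ### Transcendence of π, after Hermite and Lindemann -/

section TranscendencePi

open Polynomial

/-- Finitely many nonzero algebraic numbers are common roots of an integer polynomial with nonzero
constant coefficient. -/
theorem exists_intPolynomial_common_root {ι K : Type*} [Field K] [CharZero K]
    (T : Finset ι) (β : ι → K) (h0 : ∀ i ∈ T, β i ≠ 0) (halg : ∀ i ∈ T, IsAlgebraic ℤ (β i)) :
    ∃ f : ℤ[X], f.eval 0 ≠ 0 ∧ ∀ i ∈ T, aeval (β i) f = 0 := by
  classical
  induction T using Finset.induction_on with
  | empty => exact ⟨1, by simp, by simp⟩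
  | insert i T hi ih =>
    obtain ⟨f, hf0, hf⟩ := ih (fun j hj => h0 j (Finset.mem_insert_of_mem hj))
      (fun j hj => halg j (Finset.mem_insert_of_mem hj))
    obtain ⟨q, hq0, hq⟩ := (halg i (Finset.mem_insert_self i T)).exists_nonzero_coeff_and_aeval_eq_zero
      (mem_nonZeroDivisors_of_ne_zero (h0 i (Finset.mem_insert_self i T)))
    refine ⟨q * f, ?_, fun j hj => ?_⟩
    · rw [eval_mul, ← coeff_zero_eq_eval_zero]
      exact mul_ne_zero hq0 hf0
    · rw [map_mul]
      rcases Finset.mem_insert.1 hj with rfl | hj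
      · rw [hq, zero_mul]
      · rw [hf j hj, mul_zero]

theorem isIntegral_pow_mul_aeval {K : Type*} [Field K] {a : ℤ} {β : K}
    (h : IsIntegral ℤ (a • β)) (p : ℤ[X]) {D : ℕ} (hD : p.natDegree ≤ D) :
    IsIntegral ℤ ((a : K) ^ D * aeval β p) := by
  rw [aeval_eq_sum_range, Finset.mul_sum]
  refine IsIntegral.sum _ fun i hi => ?_
  have hi' : i ≤ D := (Nat.lt_succ_iff.1 (Finset.mem_range.1 hi)).trans hD
  have : (a : K) ^ D * p.coeff i • β ^ i
      = ((a ^ (D - i) * p.coeff i : ℤ) : K) * (a • β) ^ i := by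
    conv_lhs => rw [← Nat.sub_add_cancel hi', pow_add]
    simp only [zsmul_eq_mul, mul_pow]
    push_cast
    ring
  rw [this]
  exact (isIntegral_algebraMap (R := ℤ) (x := a ^ (D - i) * p.coeff i)).mul (h.pow i)

/-- Hermite's method: approximating all `exp (β i)` simultaneously, with common factor n prime to p,
turns a vanishing sum into an integer that is not divisible by p and yet has absolute value below 1.
-/
theorem natCast_add_sum_exp_ne_zero {ι : Type*} (T : Finset ι) (β : ι → ℂ) {k : ℕ} (hk : 0 < k)
    {f : ℤ[X]} (hf0 : f.eval 0 ≠ 0) (hroot : ∀ i ∈ T, aeval (β i) f = 0)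
    (hint : ∀ (q : ℤ[X]) (D : ℕ), q.natDegree ≤ D →
      ∃ m : ℤ, (f.leadingCoeff : ℂ) ^ D * ∑ i ∈ T, aeval (β i) q = m) :
    (k : ℂ) + ∑ i ∈ T, Complex.exp (β i) ≠ 0 := by
  intro hsum
  obtain ⟨c, hc⟩ := LindemannWeierstrass.exp_polynomial_approx f hf0
  have hfne : f ≠ 0 := by rintro rfl; simp at hf0
  set a := f.leadingCoeff with ha
  set d := f.natDegree with hd
  have ha0 : a ≠ 0 := leadingCoeff_ne_zero.2 hfne
  set C : ℝ := |(a : ℝ)| ^ d * c with hC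
  have hlim : Filter.Tendsto (fun n : ℕ => (T.card : ℝ) * (C * (C ^ n / (n.factorial : ℝ))))
      Filter.atTop (nhds 0) := by
    simpa using ((FloorSemiring.tendsto_pow_div_factorial_atTop C).const_mul C).const_mul
      (T.card : ℝ)
  obtain ⟨N, hN⟩ := Filter.eventually_atTop.1 (hlim.eventually (gt_mem_nhds one_pos))
  -- p must exceed |f(0)| for the approximation, |a| and k so as to divide neither, and N + 1 so
  -- that p - 1 lies in the range of the limit estimate.
  obtain ⟨p, hpN, hp⟩ := Nat.exists_infinite_primes
    (N + (f.eval 0).natAbs + a.natAbs + k + 2)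
  obtain ⟨n, hpn, q, hq, hapx⟩ := hc p (by lia) hp
  obtain ⟨m, hm⟩ := hint q (p * d) (hq.trans (Nat.sub_le _ _))
  have hprime : Prime (p : ℤ) := Nat.prime_iff_prime_int.1 hp
  have hM : ¬ (p : ℤ) ∣ a ^ (p * d) * n * k + p * m := by
    rw [dvd_add_left (dvd_mul_right _ _)]
    intro h
    rcases hprime.dvd_or_dvd h with h | h
    · rcases hprime.dvd_or_dvd h with h | h
      · have := Nat.le_of_dvd (Int.natAbs_pos.2 ha0) (Int.natCast_dvd.1 (hprime.dvd_of_dvd_pow h))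
        lia
      · exact hpn h
    · have := Nat.le_of_dvd hk (Int.natCast_dvd_natCast.1 h)
      lia
  have hM1 : (1 : ℝ) ≤ ‖((a ^ (p * d) * n * k + p * m : ℤ) : ℂ)‖ := by
    rw [Complex.norm_intCast]
    have h0 : a ^ (p * d) * n * k + p * m ≠ 0 := fun h => hM (h ▸ dvd_zero _)
    exact_mod_cast Int.one_le_abs h0
  have hrepr : ((a ^ (p * d) * n * k + p * m : ℤ) : ℂ)
      = -((a : ℂ) ^ (p * d) * ∑ i ∈ T, (n • Complex.exp (β i) - p • aeval (β i) q)) := by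
    have h1 : ∑ i ∈ T, Complex.exp (β i) = -(k : ℂ) := by linear_combination hsum
    rw [Finset.sum_sub_distrib, ← Finset.smul_sum, ← Finset.smul_sum, h1]
    push_cast
    rw [← hm]
    simp only [zsmul_eq_mul, nsmul_eq_mul]
    ring
  have hbound : ‖((a ^ (p * d) * n * k + p * m : ℤ) : ℂ)‖
      ≤ |(a : ℝ)| ^ (p * d) * (T.card * (c ^ p / ((p - 1).factorial : ℝ))) := by
    rw [hrepr, norm_neg, norm_mul, norm_pow, Complex.norm_intCast]
    refine mul_le_mul_of_nonneg_left ?_ (by positivity)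
    refine (norm_sum_le _ _).trans ?_
    rw [← nsmul_eq_mul]
    refine Finset.sum_le_card_nsmul _ _ _ fun i hi => hapx ?_
    exact (mem_aroots).2 ⟨hfne, hroot i hi⟩
  have hlt := hN (p - 1) (by lia)
  have heq : |(a : ℝ)| ^ (p * d) * (T.card * (c ^ p / ((p - 1).factorial : ℝ)))
      = (T.card : ℝ) * (C * (C ^ (p - 1) / ((p - 1).factorial : ℝ))) := by
    have : C * C ^ (p - 1) = |(a : ℝ)| ^ (p * d) * c ^ p := by
      rw [← pow_succ', Nat.sub_add_cancel hp.one_le, hC, mul_pow, ← pow_mul, mul_comm d p]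
    rw [← mul_div_assoc C, this]
    ring
  linarith

/-- The product of 1 + exp(σ(πi)) over the Galois group vanishes by Euler's identity. Expanded, it
is a sum of exponentials of subset sums of conjugates; the zero subset sums give a positive integer,
and the Galois group permutes the others. -/
theorem not_isAlgebraic_pi_mul_I : ¬ IsAlgebraic ℚ ((Real.pi : ℂ) * Complex.I) := by
  classical
  intro halg
  set α : ℂ := (Real.pi : ℂ) * Complex.I with hα
  set P := minpoly ℚ α with hP
  have hirr : Irreducible P := minpoly.irreducible halg.isIntegral
  let K := IntermediateField.adjoin ℚ (P.rootSet ℂ)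
  have : P.IsSplittingField ℚ K :=
    IntermediateField.adjoin_rootSet_isSplittingField (IsAlgClosed.splits _)
  have : FiniteDimensional ℚ K := Polynomial.IsSplittingField.finiteDimensional K P
  have : IsGalois ℚ K := IsGalois.of_separable_splitting_field hirr.separable
  have hαK : α ∈ K := IntermediateField.subset_adjoin _ _
    (mem_rootSet.2 ⟨hirr.ne_zero, minpoly.aeval ℚ α⟩)
  let a : K := ⟨α, hαK⟩
  let b : Finset Gal(K/ℚ) → K := fun S => ∑ σ ∈ S, σ a
  have hprod : ∏ σ : Gal(K/ℚ), (1 + Complex.exp ((σ a : K) : ℂ)) = 0 := by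
    refine Finset.prod_eq_zero (Finset.mem_univ 1) ?_
    change 1 + Complex.exp α = 0
    rw [hα, Complex.exp_pi_mul_I]
    ring
  rw [Finset.prod_one_add, Finset.powerset_univ] at hprod
  have hexp : ∀ S : Finset Gal(K/ℚ), ∏ σ ∈ S, Complex.exp ((σ a : K) : ℂ)
      = Complex.exp ((b S : K) : ℂ) := by
    intro S
    rw [← Complex.exp_sum]
    simp [b]
  simp_rw [hexp] at hprod
  set Z := Finset.univ.filter (fun S : Finset Gal(K/ℚ) => b S = 0) with hZ
  set T := Finset.univ.filter (fun S : Finset Gal(K/ℚ) => ¬ b S = 0) with hT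
  have hk : 0 < Z.card := Finset.card_pos.2 ⟨∅, by simp [hZ, b]⟩
  have hsplit : (Z.card : ℂ) + ∑ S ∈ T, Complex.exp ((b S : K) : ℂ) = 0 := by
    rw [← hprod, ← Finset.sum_filter_add_sum_filter_not Finset.univ
      (fun S : Finset Gal(K/ℚ) => b S = 0)]
    congr 1
    rw [Finset.sum_congr rfl (g := fun _ => (1 : ℂ)), Finset.sum_const, nsmul_eq_mul, mul_one]
    intro S hS
    rw [(Finset.mem_filter.1 hS).2]
    simp
  have halgK : ∀ x : K, IsAlgebraic ℤ x := fun x =>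
    (IsFractionRing.isAlgebraic_iff ℤ ℚ K).2 (Algebra.IsAlgebraic.isAlgebraic x)
  obtain ⟨f, hf0, hf⟩ := exists_intPolynomial_common_root T b
    (fun S hS => (Finset.mem_filter.1 hS).2) (fun S _ => halgK _)
  have hcoe : ∀ (x : K) (q : ℤ[X]), aeval ((x : K) : ℂ) q = ((aeval x q : K) : ℂ) := fun x q =>
    aeval_algebraMap_apply ℂ x q
  refine natCast_add_sum_exp_ne_zero T (fun S => ((b S : K) : ℂ)) hk hf0
    (fun S hS => by rw [hcoe, hf S hS]; rfl) (fun q D hD => ?_) hsplit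
  set s : K := (f.leadingCoeff : K) ^ D * ∑ S ∈ T, aeval (b S) q with hs
  have hs_int : IsIntegral ℤ s := by
    rw [hs, Finset.mul_sum]
    exact IsIntegral.sum _ fun S hS =>
      isIntegral_pow_mul_aeval (isIntegral_leadingCoeff_smul f (b S) (hf S hS)) q hD
  have hfix : ∀ τ : Gal(K/ℚ), τ s = s := by
    intro τ
    -- Left translation by τ permutes the subsets, so s is Galois-invariant, hence rational; being
    -- integral, it is an integer.
    have hb : ∀ S, τ (b S) = b ((Equiv.mulLeft τ).finsetCongr S) := by
      intro S
      simp [b, Equiv.finsetCongr_apply, map_sum]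
    rw [hs, map_mul, map_pow, map_intCast, map_sum]
    congr 1
    refine Finset.sum_equiv ((Equiv.mulLeft τ).finsetCongr) (fun S => ?_) (fun S _ => ?_)
    · simp only [hT, Finset.mem_filter, Finset.mem_univ, true_and, ← hb]
      simp
    · rw [← hb]
      exact (aeval_algHom_apply (τ : K →ₐ[ℚ] K).toIntAlgHom (b S) q).symm
  obtain ⟨r, hr⟩ := (IsGalois.mem_range_algebraMap_iff_fixed s).2 hfix
  have hr_int : IsIntegral ℤ r :=
    (isIntegral_algebraMap_iff (algebraMap ℚ K).injective).1 (hr ▸ hs_int)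
  obtain ⟨m, hm⟩ := IsIntegrallyClosed.isIntegral_iff.1 hr_int
  refine ⟨m, ?_⟩
  have h1 : ((s : K) : ℂ) = (m : ℂ) := by
    rw [← hr, ← hm]
    simp
  rw [← h1, hs]
  simp only [hcoe]
  push_cast
  rfl

theorem transcendental_pi : Transcendental ℚ Real.pi := by
  intro h
  have h1 : IsAlgebraic ℚ (Real.pi : ℂ) :=
    (isAlgebraic_algebraMap_iff (algebraMap ℝ ℂ).injective).2 h
  have hI : IsAlgebraic ℚ Complex.I := ⟨X ^ 2 + 1, by
    intro h0
    have := congrArg (fun p : ℚ[X] => p.eval 0) h0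
    simp at this, by simp⟩
  exact not_isAlgebraic_pi_mul_I (h1.mul hI)

end TranscendencePi

/-! ### Specialization and simplicity of roots -/

open Polynomial Topology

/-- The univariate real polynomial `g(x, ·)`. -/
def specializeX (g : ℚ[X][Y]) (x : ℝ) : ℝ[X] :=
  g.map (aeval (R := ℚ) x).toRingHom

theorem evalReal_eq_eval (g : ℚ[X][Y]) (x y : ℝ) :
    evalReal g x y = (specializeX g x).eval y := by
  rw [evalReal, specializeX, eval_map]
  induction g using Polynomial.induction_on' with
  | add p q hp hq => rw [map_add, eval₂_add, hp, hq]
  | monomial n a => simp [← C_mul_X_pow_eq_monomial]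

theorem evalReal_eq_sum (g : ℚ[X][Y]) (x y : ℝ) :
    evalReal g x y = ∑ i ∈ Finset.range (g.natDegree + 1), aeval x (g.coeff i) * y ^ i := by
  rw [evalReal_eq_eval, specializeX, eval_map, eval₂_eq_sum_range]
  rfl

theorem evalReal_ratCast (g : ℚ[X][Y]) (x : ℝ) (q : ℚ) :
    evalReal g x q = aeval x (g.eval (C q)) := by
  rw [evalReal_eq_sum, eval_eq_sum_range, map_sum]
  simp

theorem specializeX_derivative (g : ℚ[X][Y]) (x : ℝ) :
    specializeX (derivative g) x = derivative (specializeX g x) :=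
  (derivative_map g _).symm

/-- The resultant ± lc · discrim is a combination of g and ∂g/∂y, so it vanishes at any common zero.
-/
theorem evalReal_derivative_ne_zero {g : ℚ[X][Y]} (hdeg : 1 ≤ g.natDegree) {x y : ℝ}
    (hlc : aeval x g.leadingCoeff ≠ 0) (hdisc : aeval x g.discr ≠ 0) (h : evalReal g x y = 0) :
    evalReal (derivative g) x y ≠ 0 := by
  intro h'
  obtain ⟨p, q, -, -, hpq⟩ := exists_mul_add_mul_eq_C_resultant g (derivative g) le_rfl
    (natDegree_derivative_le g) (Or.inl (by lia))
  rw [resultant_deriv (natDegree_pos_iff_degree_pos.1 hdeg)] at hpq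
  have := congrArg (aevalAeval x y) hpq
  rw [map_add, map_mul, map_mul, show aevalAeval x y g = 0 from h,
    show aevalAeval x y (derivative g) = 0 from h', aevalAeval_C] at this
  simp only [zero_mul, add_zero, map_mul, map_pow, map_neg, map_one] at this
  exact mul_ne_zero (mul_ne_zero (pow_ne_zero _ (by norm_num)) hlc) hdisc this.symm

/-! ### Squarefreeness and the discriminant -/

/-- Gauss's lemma: q is associated over K to a primitive polynomial over R, whose square then
divides g already over R. -/
theorem isUnit_of_sq_dvd_map {R K : Type*} [CommRing R] [IsDomain R] [UniqueFactorizationMonoid R]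
    [Field K] [Algebra R K] [IsFractionRing R K] {g : R[X]} (hg : Squarefree g) {q : K[X]}
    (hq : q * q ∣ g.map (algebraMap R K)) (hq0 : q ≠ 0) : IsUnit q := by
  classical
  let := UniqueFactorizationMonoid.strongNormalizationMonoid (α := R)
  let := UniqueFactorizationMonoid.toNormalizedGCDMonoid R
  have hinj := IsFractionRing.injective R K
  obtain ⟨c, hc, hcq⟩ := IsLocalization.integerNormalization_spec (nonZeroDivisors R) q
  set r := IsLocalization.integerNormalization (nonZeroDivisors R) q
  have hc0 : algebraMap R K c ≠ 0 :=
    (map_ne_zero_iff _ hinj).2 (nonZeroDivisors.ne_zero hc)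
  have hr : r.map (algebraMap R K) = C (algebraMap R K c) * q := by
    rw [hcq, ← smul_eq_C_mul, algebraMap_smul]
  have hr0 : r ≠ 0 := by
    intro h
    rw [h, Polynomial.map_zero] at hr
    exact mul_ne_zero (C_ne_zero.2 hc0) hq0 hr.symm
  have hcont : algebraMap R K r.content ≠ 0 :=
    (map_ne_zero_iff _ hinj).2 (content_eq_zero_iff.not.2 hr0)
  have hassoc : Associated (r.primPart.map (algebraMap R K)) q := by
    have h1 : C (algebraMap R K r.content) * r.primPart.map (algebraMap R K)
        = C (algebraMap R K c) * q := by
      rw [← hr, ← map_C, ← Polynomial.map_mul, ← eq_C_content_mul_primPart]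
    have h2 := associated_unit_mul_left (r.primPart.map (algebraMap R K)) _
      (isUnit_C.2 hcont.isUnit)
    have h3 := associated_unit_mul_left q _ (isUnit_C.2 hc0.isUnit)
    exact h2.symm.trans ((Associated.of_eq h1).trans h3)
  have hprim := r.isPrimitive_primPart
  have hdvd : r.primPart * r.primPart ∣ g := by
    refine (hprim.mul hprim).dvd_of_fraction_map_dvd_fraction_map (K := K) ?_
    rw [Polynomial.map_mul]
    exact (hassoc.mul_mul hassoc).dvd.trans hq
  exact hassoc.isUnit ((hg _ hdvd).map (mapRingHom (algebraMap R K)))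

theorem discr_ne_zero {R : Type*} [CommRing R] [IsDomain R] [UniqueFactorizationMonoid R]
    [CharZero R] {g : R[X]} (hg : Squarefree g) (hdeg : 1 ≤ g.natDegree) : g.discr ≠ 0 := by
  let K := FractionRing R
  have hinj := IsFractionRing.injective R K
  have : CharZero K := charZero_of_injective_algebraMap hinj
  have hsq : Squarefree (g.map (algebraMap R K)) := by
    intro q hq
    refine isUnit_of_sq_dvd_map hg hq ?_
    rintro rfl
    rw [zero_mul, zero_dvd_iff, Polynomial.map_eq_zero_iff hinj] at hq
    simp [hq] at hdeg
  have hsep := PerfectField.separable_iff_squarefree.2 hsq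
  intro h0
  have hres := resultant_deriv (natDegree_pos_iff_degree_pos.1 hdeg)
  rw [h0, mul_zero, ← natDegree_derivative] at hres
  have := congrArg (algebraMap R K) hres
  rw [map_zero, ← resultant_map_map, ← derivative_map, ← natDegree_map_eq_of_injective hinj g,
    ← natDegree_map_eq_of_injective hinj (derivative g), ← derivative_map] at this
  exact (resultant_eq_zero_iff.1 this).2 hsep

/-- Here y - q divides g, and leading coefficients in x are multiplicative. -/
theorem leadCoeffX_root {g : ℚ[X][Y]} (q : ℚ) (h : g.eval (C q) = 0) :
    (leadCoeffX g).eval q = 0 := by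
  obtain ⟨p, rfl⟩ := dvd_iff_isRoot.2 (h : IsRoot g (C q))
  rw [leadCoeffX, map_mul, map_sub, Bivariate.swap_Y, Bivariate.swap_C_C, ← C_sub,
    leadingCoeff_mul, leadingCoeff_C]
  simp

/-! ### The real curve and its branches -/

theorem contDiff_evalReal (g : ℚ[X][Y]) :
    ContDiff ℝ 1 (fun p : ℝ × ℝ => evalReal g p.1 p.2) := by
  simp only [evalReal_eq_sum]
  refine ContDiff.sum fun i _ => ContDiff.mul ?_ (contDiff_snd.pow i)
  exact (Polynomial.contDiff_aeval (g.coeff i) 1).comp contDiff_fst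

theorem hasDerivAt_evalReal (g : ℚ[X][Y]) (x y : ℝ) :
    HasDerivAt (fun t => evalReal g x t) (evalReal (derivative g) x y) y := by
  simp only [evalReal_eq_eval, specializeX_derivative]
  exact (specializeX g x).hasDerivAt y

/-- A Cauchy root bound, continuous in the coefficients where the leading one is nonzero; this makes
the curve over a compact interval compact. -/
theorem abs_le_of_sum_mul_pow_eq_zero {n : ℕ} {a : ℕ → ℝ} {y : ℝ} (ha : a n ≠ 0)
    (h : ∑ i ∈ Finset.range (n + 1), a i * y ^ i = 0) :
    |y| ≤ 1 + (∑ i ∈ Finset.range n, |a i|) / |a n| := by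
  have hn : 0 < |a n| := abs_pos.2 ha
  have hS : 0 ≤ (∑ i ∈ Finset.range n, |a i|) / |a n| := by positivity
  rcases le_or_gt |y| 1 with hy | hy
  · linarith
  rw [Finset.sum_range_succ] at h
  rcases n with _ | m
  · simp at h
    exact absurd h ha
  have h1 : |a (m + 1)| * |y| ^ (m + 1) ≤ (∑ i ∈ Finset.range (m + 1), |a i|) * |y| ^ m := by
    rw [← abs_pow, ← abs_mul, show a (m + 1) * y ^ (m + 1)
      = -∑ i ∈ Finset.range (m + 1), a i * y ^ i by linarith, abs_neg, Finset.sum_mul]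
    refine (Finset.abs_sum_le_sum_abs _ _).trans (Finset.sum_le_sum fun i hi => ?_)
    rw [abs_mul, abs_pow]
    exact mul_le_mul_of_nonneg_left
      (pow_le_pow_right₀ hy.le (Nat.lt_succ_iff.1 (Finset.mem_range.1 hi))) (abs_nonneg _)
  have h2 : |a (m + 1)| * |y| ≤ ∑ i ∈ Finset.range (m + 1), |a i| := by
    rw [pow_succ', ← mul_assoc] at h1
    exact le_of_mul_le_mul_right h1 (by positivity)
  have h3 : |y| ≤ (∑ i ∈ Finset.range (m + 1), |a i|) / |a (m + 1)| := by
    rw [le_div_iff₀ hn]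
    linarith
  linarith

/-- The part of the real curve `g = 0` over `[u, v]`. -/
def curveOver (g : ℚ[X][Y]) (u v : ℝ) : Set (ℝ × ℝ) :=
  {p | p.1 ∈ Set.Icc u v ∧ evalReal g p.1 p.2 = 0}

theorem isCompact_curveOver {g : ℚ[X][Y]} {u v : ℝ}
    (hlc : ∀ x ∈ Set.Icc u v, aeval x g.leadingCoeff ≠ 0) : IsCompact (curveOver g u v) := by
  have hcont : ContinuousOn (fun x : ℝ => 1 + (∑ i ∈ Finset.range g.natDegree,
      |aeval x (g.coeff i)|) / |aeval x g.leadingCoeff|) (Set.Icc u v) := by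
    refine continuousOn_const.add (ContinuousOn.div ?_ ?_ fun x hx => abs_ne_zero.2 (hlc x hx))
    · exact (continuous_finsetSum _ fun i _ =>
        (Polynomial.continuous_aeval (g.coeff i)).abs).continuousOn
    · exact (Polynomial.continuous_aeval g.leadingCoeff).abs.continuousOn
  obtain ⟨B, hB⟩ := isCompact_Icc.bddAbove_image hcont
  refine IsCompact.of_isClosed_subset
    (isCompact_Icc.prod (isCompact_Icc (a := -B) (b := B)) : IsCompact (Set.Icc u v ×ˢ _)) ?_ ?_
  · exact (isClosed_Icc.preimage continuous_fst).inter
      (isClosed_singleton.preimage (contDiff_evalReal g).continuous)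
  · rintro ⟨x, y⟩ ⟨hx, hy⟩
    refine ⟨hx, abs_le.1 ?_⟩
    rw [evalReal_eq_sum] at hy
    exact (abs_le_of_sum_mul_pow_eq_zero (a := fun i => aeval x (g.coeff i)) (hlc x hx) hy).trans
      (hB (Set.mem_image_of_mem _ hx))

/-- The inverse function theorem for (x, y) ↦ (x, g(x, y)), which straightens the curve to the axis.
-/
theorem exists_openPartialHomeomorph_evalReal (g : ℚ[X][Y]) {x y : ℝ}
    (h : evalReal (derivative g) x y ≠ 0) :
    ∃ Φ : OpenPartialHomeomorph (ℝ × ℝ) (ℝ × ℝ), (x, y) ∈ Φ.source ∧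
      ∀ p, Φ p = (p.1, evalReal g p.1 p.2) := by
  set F : ℝ × ℝ → ℝ := fun p => evalReal g p.1 p.2 with hF
  have hstrict : HasStrictFDerivAt F (fderiv ℝ F (x, y)) (x, y) :=
    (contDiff_evalReal g).contDiffAt.hasStrictFDerivAt one_ne_zero
  have hd : fderiv ℝ F (x, y) (0, 1) = evalReal (derivative g) x y := by
    have h1 : HasDerivAt (fun t : ℝ => ((x, t) : ℝ × ℝ)) (0, 1) y :=
      (hasDerivAt_const y x).prodMk (hasDerivAt_id y)
    exact (hstrict.hasFDerivAt.comp_hasDerivAt y h1).unique (hasDerivAt_evalReal g x y)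
  let L : (ℝ × ℝ) →L[ℝ] (ℝ × ℝ) := (ContinuousLinearMap.fst ℝ ℝ ℝ).prod (fderiv ℝ F (x, y))
  have hker : LinearMap.ker (L : (ℝ × ℝ) →ₗ[ℝ] (ℝ × ℝ)) = ⊥ := by
    rw [LinearMap.ker_eq_bot']
    rintro ⟨a, b⟩ hab
    have ha : a = 0 := congrArg Prod.fst hab
    have hb : fderiv ℝ F (x, y) (a, b) = 0 := congrArg Prod.snd hab
    subst ha
    rw [show ((0 : ℝ), b) = b • ((0 : ℝ), (1 : ℝ)) by simp, map_smul, hd, smul_eq_mul,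
      mul_eq_zero, or_iff_left h] at hb
    rw [hb]
    rfl
  let e : (ℝ × ℝ) ≃L[ℝ] (ℝ × ℝ) := (LinearEquiv.ofInjectiveEndo
    (L : (ℝ × ℝ) →ₗ[ℝ] (ℝ × ℝ)) (LinearMap.ker_eq_bot.1 hker)).toContinuousLinearEquiv
  have he : HasStrictFDerivAt (fun p : ℝ × ℝ => (p.1, F p)) (e : (ℝ × ℝ) →L[ℝ] (ℝ × ℝ)) (x, y) := by
    have : (e : (ℝ × ℝ) →L[ℝ] (ℝ × ℝ)) = L := rfl
    rw [this]
    exact hasStrictFDerivAt_fst.prodMk hstrict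
  exact ⟨he.toOpenPartialHomeomorph _, he.mem_toOpenPartialHomeomorph_source, fun p => rfl⟩

theorem isLocalHomeomorphOn_curveOver_fst {g : ℚ[X][Y]} {u v : ℝ}
    (hsimple : ∀ p ∈ curveOver g u v, evalReal (derivative g) p.1 p.2 ≠ 0) :
    IsLocalHomeomorphOn (fun e : curveOver g u v => (e : ℝ × ℝ).1)
      ((fun e : curveOver g u v => (e : ℝ × ℝ).1) ⁻¹' Set.Ioo u v) := by
  rw [isLocalHomeomorphOn_iff_isOpenEmbedding_restrict]
  rintro e he
  obtain ⟨Φ, hΦe, hΦ⟩ := exists_openPartialHomeomorph_evalReal g (hsimple e e.2)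
  -- Inside the open strip, every zero of g belongs to `curveOver g u v`, so the straightened piece
  -- is open in the axis.
  set W : Set (ℝ × ℝ) := Φ.source ∩ Prod.fst ⁻¹' Set.Ioo u v with hW
  have hWo : IsOpen W := Φ.open_source.inter (isOpen_Ioo.preimage continuous_fst)
  have hVo : IsOpen ((Subtype.val : curveOver g u v → ℝ × ℝ) ⁻¹' W) :=
    hWo.preimage continuous_subtype_val
  have hΦz : ∀ e : curveOver g u v, Φ (e : ℝ × ℝ) = ((e : ℝ × ℝ).1, 0) := fun e => by
    rw [hΦ, e.2.2]
  refine ⟨Subtype.val ⁻¹' W, hVo.mem_nhds ⟨hΦe, he⟩,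
    IsOpenEmbedding.of_continuous_injective_isOpenMap ?_ ?_ ?_⟩
  · exact (continuous_fst.comp continuous_subtype_val).comp continuous_subtype_val
  · rintro ⟨e₁, h₁⟩ ⟨e₂, h₂⟩ h
    have h' : (e₁ : ℝ × ℝ).1 = (e₂ : ℝ × ℝ).1 := h
    refine Subtype.ext (Subtype.ext (Φ.injOn h₁.1 h₂.1 ?_))
    rw [hΦz, hΦz, h']
  · intro O hO
    obtain ⟨O₁, hO₁, rfl⟩ := isOpen_induced_iff.1 hO
    obtain ⟨O₂, hO₂, rfl⟩ := isOpen_induced_iff.1 hO₁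
    have himg : IsOpen (Φ '' (O₂ ∩ W)) :=
      Φ.isOpen_image_of_subset_source (hO₂.inter hWo) fun p hp => hp.2.1
    convert himg.preimage (f := fun t : ℝ => (t, (0 : ℝ))) (by fun_prop) using 1
    ext t
    constructor
    · rintro ⟨⟨e', he'⟩, hmem, rfl⟩
      exact ⟨e', ⟨hmem, he'⟩, hΦz e'⟩
    · rintro ⟨p, ⟨hpO, hpW⟩, hpt⟩
      rw [hΦ, Prod.mk.injEq] at hpt
      exact ⟨⟨⟨p, ⟨Set.Ioo_subset_Icc_self hpW.2, hpt.2⟩⟩, hpW⟩, hpO, hpt.1⟩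

/-- Through every point of the curve there passes exactly one continuous real root function
(a branch) as long as the leading coefficient and the discriminant do not vanish; the branches
through different points over the same abscissa never meet. -/
theorem exists_root_branches {g : ℚ[X][Y]} (hdeg : 1 ≤ g.natDegree) {u u₁ v₁ v x₀ : ℝ}
    (hu : u < u₁) (hx₀ : x₀ ∈ Set.Icc u₁ v₁) (hv : v₁ < v)
    (hlc : ∀ x ∈ Set.Icc u v, aeval x g.leadingCoeff ≠ 0)
    (hdisc : ∀ x ∈ Set.Icc u v, aeval x g.discr ≠ 0) :
    ∃ B : ℝ → ℝ → ℝ, ∀ r, evalReal g x₀ r = 0 →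
      Continuous (B r) ∧ B r x₀ = r ∧ (∀ x ∈ Set.Icc u₁ v₁, evalReal g x (B r x) = 0) ∧
      ∀ r', evalReal g x₀ r' = 0 → ∀ x ∈ Set.Icc u₁ v₁, B r x = B r' x → r = r' := by
  classical
  have := isCompact_iff_compactSpace.1 (isCompact_curveOver hlc)
  set π : curveOver g u v → ℝ := fun e => (e : ℝ × ℝ).1 with hπ
  -- Compactness of the curve upgrades the local homeomorphism to a covering.
  have hcov : IsCoveringMapOn π (Set.Ioo u v) :=
    IsCoveringMapOn.of_isLocalHomeomorphOn (continuous_fst.comp continuous_subtype_val)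
      (isLocalHomeomorphOn_curveOver_fst fun p hp =>
        evalReal_derivative_ne_zero hdeg (hlc _ hp.1) (hdisc _ hp.1) hp.2)
  -- Clamping to [u₁, v₁] gives a path defined on all of ℝ, so the lifted branches are globally
  -- continuous.
  let γ : C(ℝ, ℝ) := ⟨fun x => max u₁ (min x v₁), by fun_prop⟩
  have hγ : ∀ x ∈ Set.Icc u₁ v₁, γ x = x := fun x hx => by
    change max u₁ (min x v₁) = x
    rw [min_eq_left hx.2, max_eq_right hx.1]
  have hγmem : ∀ x, γ x ∈ Set.Ioo u v := fun x =>
    ⟨hu.trans_le (le_max_left _ _),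
      (max_le (hx₀.1.trans hx₀.2) (min_le_right _ _)).trans_lt hv⟩
  have hmem : ∀ r, evalReal g x₀ r = 0 → (x₀, r) ∈ curveOver g u v := fun r hr =>
    ⟨⟨hu.le.trans hx₀.1, hx₀.2.trans hv.le⟩, hr⟩
  have hlift : ∀ r (hr : evalReal g x₀ r = 0), ∃ F : C(ℝ, curveOver g u v),
      F x₀ = ⟨(x₀, r), hmem r hr⟩ ∧ π ∘ F = γ := fun r hr =>
    (hcov.existsUnique_continuousMap_lifts γ (a₀ := x₀) (e₀ := ⟨(x₀, r), hmem r hr⟩)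
      (hγ x₀ hx₀).symm hγmem).exists
  choose F hF₀ hF using hlift
  refine ⟨fun r x => if hr : evalReal g x₀ r = 0 then ((F r hr x : ℝ × ℝ)).2 else 0,
    fun r hr => ?_⟩
  have hfst : ∀ r (hr : evalReal g x₀ r = 0), ∀ x ∈ Set.Icc u₁ v₁, (F r hr x : ℝ × ℝ).1 = x :=
    fun r hr x hx => (congrFun (hF r hr) x).trans (hγ x hx)
  simp only [hr, dite_true]
  refine ⟨by fun_prop, by rw [hF₀], fun x hx => ?_, fun r' hr' x hx h => ?_⟩
  · have := (F r hr x).2.2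
    rwa [hfst r hr x hx] at this
  · simp only [hr', dite_true] at h
    have hx_eq : F r hr x = F r' hr' x :=
      Subtype.ext (Prod.ext ((hfst r hr x hx).trans (hfst r' hr' x hx).symm) h)
    -- Branches that meet at x are lifts of γ through one point, hence equal, also over x₀.
    have huniq := (hcov.existsUnique_continuousMap_lifts γ (a₀ := x) (e₀ := F r hr x)
      (congrFun (hF r hr) x) hγmem).unique ⟨rfl, hF r hr⟩ ⟨hx_eq.symm, hF r' hr'⟩
    have h0 := congrArg (fun G : C(ℝ, curveOver g u v) => (G x₀ : ℝ × ℝ).2) huniq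
    simpa [hF₀] using h0

/-! ### Nonvanishing of the bounding polynomial -/

theorem IsGeneralPotentialPeriodic.strictMono_b {g : ℚ[X][Y]} {I : IntervalList}
    (hI : IsGeneralPotentialPeriodic g I) : StrictMono I.b :=
  Fin.strictMono_iff_lt_succ.2 fun i => (hI.b_le_a i.castSucc).trans_lt (hI.a_lt_b i)

theorem IsGeneralPotentialPeriodic.strictMono_a {g : ℚ[X][Y]} {I : IntervalList}
    (hI : IsGeneralPotentialPeriodic g I) : StrictMono I.a :=
  Fin.strictMono_iff_lt_succ.2 fun i => (hI.a_lt_b i).trans_le (hI.b_le_a i.succ)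

theorem IsGeneralPotentialPeriodic.eval_ne_zero {g : ℚ[X][Y]} {I : IntervalList}
    (hI : IsGeneralPotentialPeriodic g I) {q : ℚ}
    (hq : ∀ i : Fin I.s, ¬ (I.a i.castSucc < q ∧ q < I.b i.succ)) : g.eval (C q) ≠ 0 := by
  intro h
  obtain ⟨i, hi⟩ := hI.root_mem (q : ℝ) (by
    have := aeval_algebraMap_apply_eq_algebraMap_eval (A := ℝ) q (leadCoeffX g)
    rw [leadCoeffX_root q h] at this
    simpa using this)
  exact hq i ⟨by exact_mod_cast hi.1, by exact_mod_cast hi.2⟩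

theorem IsGeneralPotentialPeriodic.eval_b_ne_zero {g : ℚ[X][Y]} {I : IntervalList}
    (hI : IsGeneralPotentialPeriodic g I) (j : Fin (I.s + 1)) : g.eval (C (I.b j)) ≠ 0 := by
  refine hI.eval_ne_zero fun i hi => ?_
  have hj : j ≤ i.castSucc := Fin.le_castSucc_iff.2 (hI.strictMono_b.lt_iff_lt.1 hi.2)
  exact absurd hi.1 (not_lt.2 ((hI.strictMono_b.monotone hj).trans (hI.b_le_a _)))

theorem IsGeneralPotentialPeriodic.eval_a_ne_zero {g : ℚ[X][Y]} {I : IntervalList}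
    (hI : IsGeneralPotentialPeriodic g I) (j : Fin (I.s + 1)) : g.eval (C (I.a j)) ≠ 0 := by
  refine hI.eval_ne_zero fun i hi => ?_
  have h1 : i.castSucc < j := hI.strictMono_a.lt_iff_lt.1 hi.1
  have h2 : j < i.succ := hI.strictMono_a.lt_iff_lt.1 (hi.2.trans_le (hI.b_le_a _))
  exact absurd h1 (not_lt.2 (Fin.le_castSucc_iff.2 h2))

theorem boundPoly_ne_zero {g : ℚ[X][Y]} {I : IntervalList} (hsq : Squarefree g)
    (hdeg : 1 ≤ g.natDegree) (hI : IsGeneralPotentialPeriodic g I) : boundPoly g I ≠ 0 := by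
  refine mul_ne_zero (mul_ne_zero (leadingCoeff_ne_zero.2 hsq.ne_zero) (discr_ne_zero hsq hdeg))
    (Finset.prod_ne_zero_iff.2 fun j _ => mul_ne_zero (hI.eval_b_ne_zero j) (hI.eval_a_ne_zero j))

theorem exists_isChoiceOfBound {g : ℚ[X][Y]} {I : IntervalList} (h : boundPoly g I ≠ 0) :
    ∃ k', IsChoiceOfBound g I k' := by
  obtain ⟨M, hM⟩ := ((boundPoly g I).aroots ℝ).toFinset.bddAbove
  obtain ⟨k', hk'⟩ := exists_nat_ge M
  refine ⟨k', fun x hx => ?_⟩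
  have h1 : x ≤ M := hM (by
    rw [Finset.mem_coe, Multiset.mem_toFinset]
    exact mem_aroots.2 ⟨h, hx⟩)
  nlinarith [Real.pi_gt_three, (Nat.cast_nonneg k' : (0 : ℝ) ≤ k')]

theorem aeval_ne_zero_at_half_odd_mul_pi {p : ℚ[X]} (hp : p ≠ 0) (k : ℕ) :
    aeval (((k : ℝ) + 1 / 2) * Real.pi) p ≠ 0 := by
  intro h
  have h1 : IsAlgebraic ℚ (((k : ℝ) + 1 / 2) * Real.pi) := ⟨p, hp, h⟩
  have h2 : IsAlgebraic ℚ (algebraMap ℚ ℝ (((k : ℚ) + 1 / 2)⁻¹)) := isAlgebraic_algebraMap _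
  have h3 := h2.mul h1
  have hk : (k : ℝ) + 1 / 2 ≠ 0 := by positivity
  have h4 : algebraMap ℚ ℝ (((k : ℚ) + 1 / 2)⁻¹) * (((k : ℝ) + 1 / 2) * Real.pi) = Real.pi := by
    simp only [eq_ratCast]
    push_cast
    field_simp
  rw [h4] at h3
  exact transcendental_pi h3

theorem IsChoiceOfBound.aeval_ne_zero {g : ℚ[X][Y]} {I : IntervalList} {k' : ℕ}
    (h : IsChoiceOfBound g I k') (hne : boundPoly g I ≠ 0) {x : ℝ}
    (hx : ((k' : ℝ) + 1 / 2) * Real.pi ≤ x) : aeval x (boundPoly g I) ≠ 0 := by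
  intro h0
  have hx' := le_antisymm (h x h0) hx
  rw [hx'] at h0
  exact aeval_ne_zero_at_half_odd_mul_pi hne k' h0

theorem factors_ne_zero_of_boundPoly {g : ℚ[X][Y]} {I : IntervalList} {x : ℝ}
    (h : aeval x (boundPoly g I) ≠ 0) :
    aeval x g.leadingCoeff ≠ 0 ∧ aeval x g.discr ≠ 0 ∧
      ∀ j, evalReal g x (I.b j) ≠ 0 ∧ evalReal g x (I.a j) ≠ 0 := by
  rw [boundPoly, map_mul, map_mul, map_prod] at h
  refine ⟨left_ne_zero_of_mul (left_ne_zero_of_mul h), right_ne_zero_of_mul (left_ne_zero_of_mul h),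
    fun j => ?_⟩
  have := Finset.prod_ne_zero_iff.1 (right_ne_zero_of_mul h) j (Finset.mem_univ j)
  rw [map_mul] at this
  rw [evalReal_ratCast, evalReal_ratCast]
  exact ⟨left_ne_zero_of_mul this, right_ne_zero_of_mul this⟩

/-! ### Root lists and counters -/

theorem exists_listsRoots {g : ℚ[X][Y]} {x₀ : ℤ} (h : aeval (x₀ : ℝ) g.leadingCoeff ≠ 0) :
    ∃ roots, ListsRoots g x₀ roots := by
  have hne : specializeX g x₀ ≠ 0 := fun h0 => h (by
    have := congrArg (fun p => p.coeff g.natDegree) h0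
    simpa [specializeX] using this)
  refine ⟨(specializeX g x₀).roots.toFinset.toList, Finset.nodup_toList _, fun r => ?_⟩
  rw [Finset.mem_toList, Multiset.mem_toFinset, mem_roots hne, evalReal_eq_eval, IsRoot.def]

-- A step raises c_j only for a root in the j-th interval. The inequality suffices, so disjointness
-- of the intervals is not needed.
open Classical in
theorem foldl_countStep_le (I : IntervalList) (j : Fin (I.s + 2)) (roots : List ℝ)
    (c : Fin (I.s + 2) → ℕ) :
    roots.foldl (countStep I) c j ≤ c j + (roots.filter (fun r => r ∈ I.interval j)).length := by
  induction roots generalizing c with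
  | nil => simp
  | cons r l ih =>
    rw [List.foldl_cons]
    refine (ih _).trans ?_
    have hstep : countStep I c r j ≤ c j + if r ∈ I.interval j then 1 else 0 := by
      rcases hfind : (List.finRange (I.s + 2)).find? (fun j => decide (r ∈ I.interval j))
        with _ | i
      · simp [countStep, hfind]
      · have hmem : r ∈ I.interval i := by simpa using List.find?_some hfind
        by_cases hij : j = i
        · subst hij
          simp [countStep, hfind, hmem]
        · simp [countStep, hfind, Function.update_of_ne hij]
    by_cases hr : r ∈ I.interval j <;> simp [hr] at hstep ⊢ <;> lia

/-! ### Crossings of the branches with tan -/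

theorem IntervalList.lower_eq (I : IntervalList) (j : Fin (I.s + 2)) :
    I.lower j = ⊥ ∨ ∃ i, I.lower j = ((I.a i : ℝ) : EReal) := by
  refine Fin.cases (Or.inl rfl) (fun i => Or.inr ⟨i, rfl⟩) j

theorem IntervalList.upper_eq (I : IntervalList) (j : Fin (I.s + 2)) :
    I.upper j = ⊤ ∨ ∃ i, I.upper j = ((I.b i : ℝ) : EReal) := by
  refine Fin.lastCases (Or.inl ?_) (fun i => Or.inr ⟨i, ?_⟩) j
  · simp [IntervalList.upper]
  · simp [IntervalList.upper]

@[simp] theorem arctanE_bot : arctanE ⊥ = -(Real.pi / 2) := by simp [arctanE]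

@[simp] theorem arctanE_top : arctanE ⊤ = Real.pi / 2 := by simp [arctanE]

@[simp] theorem arctanE_coe (t : ℝ) : arctanE t = Real.arctan t := by simp [arctanE]

theorem arctanE_strictMono : StrictMono arctanE := by
  intro s t hst
  induction s <;> induction t <;> simp at hst ⊢
  · exact Real.neg_pi_div_two_lt_arctan _
  · linarith [Real.pi_pos]
  · exact hst
  · exact Real.arctan_lt_pi_div_two _

theorem neg_pi_div_two_le_arctanE (t : EReal) : -(Real.pi / 2) ≤ arctanE t :=
  arctanE_bot ▸ arctanE_strictMono.monotone bot_le

theorem arctanE_le_pi_div_two (t : EReal) : arctanE t ≤ Real.pi / 2 :=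
  arctanE_top ▸ arctanE_strictMono.monotone le_top

/-- A continuous function that starts in one of the intervals and avoids all finite endpoints
stays in the interval. -/
theorem mem_interval_of_continuousOn (I : IntervalList) (j : Fin (I.s + 2)) {J : Set ℝ}
    (hJ : IsPreconnected J) {f : ℝ → ℝ} (hf : ContinuousOn f J)
    (hb : ∀ x ∈ J, ∀ i, f x ≠ I.b i ∧ f x ≠ I.a i) {x₀ x : ℝ} (hx₀ : x₀ ∈ J) (hx : x ∈ J)
    (h : f x₀ ∈ I.interval j) : f x ∈ I.interval j := by
  constructor
  · rcases I.lower_eq j with hl | ⟨i, hl⟩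
    · rw [hl]
      exact EReal.bot_lt_coe _
    · have h1 := h.1
      rw [hl, EReal.coe_lt_coe_iff] at h1 ⊢
      by_contra! hle
      obtain ⟨z, hz, hzv⟩ := hJ.intermediate_value hx hx₀ hf ⟨hle, h1.le⟩
      exact (hb z hz i).2 hzv
  · rcases I.upper_eq j with hl | ⟨i, hl⟩
    · rw [hl]
      exact EReal.coe_lt_top _
    · have h1 := h.2
      rw [hl, EReal.coe_lt_coe_iff] at h1 ⊢
      by_contra! hle
      obtain ⟨z, hz, hzv⟩ := hJ.intermediate_value hx₀ hx hf ⟨h1.le, hle⟩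
      exact (hb z hz i).1 hzv

/-- A continuous function with values in `(s, t)` meets the branch of `tan` over
`(kπ - π/2, kπ + π/2)` between `arctan s + kπ` and `arctan t + kπ`. -/
theorem exists_tan_eq {f : ℝ → ℝ} {s t : EReal} {k : ℕ} (hst : s < t) (hf : Continuous f)
    (hmem : ∀ x ∈ Set.Icc (arctanE s + k * Real.pi) (arctanE t + k * Real.pi),
      s < (f x : EReal) ∧ (f x : EReal) < t) :
    ∃ x ∈ Set.Ioo (arctanE s + k * Real.pi) (arctanE t + k * Real.pi),
      Real.cos x ≠ 0 ∧ Real.tan x = f x := by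
  set l := arctanE s + k * Real.pi
  set r := arctanE t + k * Real.pi
  have hlr : l < r := by
    have := arctanE_strictMono hst
    simp only [l, r]
    linarith
  have hlo : ∀ x ∈ Set.Icc l r, l < Real.arctan (f x) + k * Real.pi := fun x hx => by
    have := arctanE_strictMono (hmem x hx).1
    rw [arctanE_coe] at this
    simp only [l]
    linarith
  have hhi : ∀ x ∈ Set.Icc l r, Real.arctan (f x) + k * Real.pi < r := fun x hx => by
    have := arctanE_strictMono (hmem x hx).2
    rw [arctanE_coe] at this
    simp only [r]
    linarith
  -- Comparing x with arctan (f x) + kπ avoids the poles of tan, which may sit at the ends of the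
  -- window.
  have hcont : ContinuousOn (fun x => x - (Real.arctan (f x) + k * Real.pi)) (Set.Icc l r) :=
    (continuous_id.sub ((Real.continuous_arctan.comp hf).add continuous_const)).continuousOn
  obtain ⟨x, hx, hx0⟩ := intermediate_value_Icc hlr.le hcont (show (0 : ℝ) ∈ _ from
    ⟨by linarith [hlo l (Set.left_mem_Icc.2 hlr.le)],
      by linarith [hhi r (Set.right_mem_Icc.2 hlr.le)]⟩)
  have hxe : x = Real.arctan (f x) + k * Real.pi := by
    simp only at hx0
    linarith
  refine ⟨x, ⟨(hlo x hx).trans_eq hxe.symm, hxe.trans_lt (hhi x hx)⟩, ?_, ?_⟩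
  · rw [hxe, Real.cos_add_nat_mul_pi]
    exact mul_ne_zero (pow_ne_zero _ (by norm_num)) (Real.cos_arctan_pos _).ne'
  · conv_lhs => rw [hxe]
    rw [Real.tan_add_nat_mul_pi, Real.tan_arctan]

theorem card_le_encard_tanRoots {g : ℚ[X][Y]} {I : IntervalList} (hdeg : 1 ≤ g.natDegree)
    {k' : ℕ} (hne : boundPoly g I ≠ 0) (hk' : IsChoiceOfBound g I k') {x₀ : ℝ}
    (hx₀ : ((k' : ℝ) + 1 / 2) * Real.pi ≤ x₀) (j : Fin (I.s + 2)) {S : Finset ℝ}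
    (hS : ∀ r ∈ S, evalReal g x₀ r = 0 ∧ r ∈ I.interval j) {k : ℕ} (hk : k' < k) :
    (S.card : ℕ∞) ≤ (tanRoots g (arctanE (I.lower j) + k * Real.pi)
      (arctanE (I.upper j) + k * Real.pi)).encard := by
  set ρ := ((k' : ℝ) + 1 / 2) * Real.pi with hρ
  -- The branches must reach both the sample point and the window, whichever lies further right.
  set v₁ := max x₀ (((k : ℝ) + 1 / 2) * Real.pi) with hv₁
  have hpos : ∀ x, ρ ≤ x → aeval x (boundPoly g I) ≠ 0 := fun x hx => hk'.aeval_ne_zero hne hx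
  -- The covering argument needs room to the left of ρ; nonvanishing at ρ itself provides it.
  obtain ⟨ε, hε, hball⟩ := Metric.eventually_nhds_iff.1
    ((Polynomial.continuous_aeval (boundPoly g I)).continuousAt.eventually_ne (hpos ρ le_rfl))
  have hall : ∀ x ∈ Set.Icc (ρ - ε / 2) (v₁ + 1), aeval x (boundPoly g I) ≠ 0 := by
    intro x hx
    rcases le_or_gt ρ x with h | h
    · exact hpos x h
    · refine hball ?_
      rw [Real.dist_eq, abs_lt]
      constructor <;> linarith [hx.1]
  have hx₀J : x₀ ∈ Set.Icc ρ v₁ := ⟨hx₀, le_max_left _ _⟩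
  obtain ⟨B, hB⟩ := exists_root_branches hdeg (by linarith : ρ - ε / 2 < ρ) hx₀J
    (lt_add_one v₁) (fun x hx => (factors_ne_zero_of_boundPoly (hall x hx)).1)
    (fun x hx => (factors_ne_zero_of_boundPoly (hall x hx)).2.1)
  have hk1 : (k' : ℝ) + 1 ≤ k := by exact_mod_cast hk
  have hsub : Set.Icc (arctanE (I.lower j) + k * Real.pi) (arctanE (I.upper j) + k * Real.pi)
      ⊆ Set.Icc ρ v₁ := by
    refine Set.Icc_subset_Icc ?_ ((?_ : _ ≤ ((k : ℝ) + 1 / 2) * Real.pi).trans (le_max_right _ _))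
    · rw [hρ]
      -- The window starts no earlier than (k - 1/2)π, which is at least ρ because k ≥ k' + 1.
      nlinarith [neg_pi_div_two_le_arctanE (I.lower j), Real.pi_pos]
    · linarith [arctanE_le_pi_div_two (I.upper j)]
  have hex : ∀ r ∈ S, ∃ x ∈ Set.Ioo (arctanE (I.lower j) + k * Real.pi)
      (arctanE (I.upper j) + k * Real.pi), Real.cos x ≠ 0 ∧ Real.tan x = B r x := by
    intro r hr
    obtain ⟨hr0, hrj⟩ := hS r hr
    obtain ⟨hcont, hstart, hroot, -⟩ := hB r hr0
    refine exists_tan_eq (hrj.1.trans hrj.2) hcont fun x hx => ?_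
    refine mem_interval_of_continuousOn I j isPreconnected_Icc hcont.continuousOn
      (fun z hz i => ?_) hx₀J (hsub hx) (by rwa [hstart])
    obtain ⟨hb, ha⟩ := (factors_ne_zero_of_boundPoly (hpos z hz.1)).2.2 i
    exact ⟨fun h => hb (h ▸ hroot z hz), fun h => ha (h ▸ hroot z hz)⟩
  choose! ξ hξ hcos htan using hex
  -- At a shared crossing both branches take the value tan, so they meet and must coincide.
  have hinj : Set.InjOn ξ S := by
    intro r hr r' hr' h
    refine (hB r (hS r hr).1).2.2.2 r' (hS r' hr').1 (ξ r)
      (hsub (Set.Ioo_subset_Icc_self (hξ r hr))) ?_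
    rw [← htan r hr, h, htan r' hr']
  rw [← Set.encard_coe_eq_coe_finsetCard, ← hinj.encard_image]
  refine Set.encard_le_encard ?_
  rintro _ ⟨r, hr, rfl⟩
  refine ⟨hξ r hr, hcos r hr, ?_⟩
  rw [htan r hr]
  exact (hB r (hS r hr).1).2.2.1 _ (hsub (Set.Ioo_subset_Icc_self (hξ r hr)))

theorem meetsSpec_output {g : ℚ[X][Y]} {I : IntervalList} (hdeg : 1 ≤ g.natDegree)
    {k' : ℕ} (hne : boundPoly g I ≠ 0) (hk' : IsChoiceOfBound g I k') {x₀ : ℤ}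
    (hx₀ : IsChoiceOfSample k' x₀) {roots : List ℝ} (hroots : ListsRoots g x₀ roots) :
    MeetsSpec g k' (output I roots) := by
  classical
  intro p hp k hk
  obtain ⟨j, -, rfl⟩ := Finset.mem_image.1 hp
  set S := (roots.filter (fun r => r ∈ I.interval j)).toFinset with hS
  have hcount : counts I roots j ≤ S.card := by
    rw [hS, List.toFinset_card_of_nodup (hroots.1.filter _)]
    simpa [counts] using foldl_countStep_le I j roots (fun _ => 0)
  refine (Nat.cast_le.2 hcount).trans
    (card_le_encard_tanRoots hdeg hne hk' hx₀.le j (fun r hr => ?_) hk)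
  rw [hS, List.mem_toFinset, List.mem_filter] at hr
  exact ⟨(hroots.2 r).1 hr.1, by simpa using hr.2⟩

end FarZero

end

/-- Correctness of `IsolatingFarZero` on every admissible input: no choice gets stuck (a number
`k'`, then a sample point `x₀`, then a finite list of the real roots of `g(x₀, y)` exist), and
whatever choices are made, the returned `k'` and `ret` meet the output specification. -/
theorem theorem3p2 (g : Polynomial (Polynomial ℚ)) (I : FarZero.IntervalList)
    (hsq : Squarefree g) (hdeg : 1 ≤ g.natDegree)
    (hI : FarZero.IsGeneralPotentialPeriodic g I) :
    (∃ k' : ℕ, FarZero.IsChoiceOfBound g I k') ∧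
    ∀ k' : ℕ, FarZero.IsChoiceOfBound g I k' →
      (∃ x₀ : ℤ, FarZero.IsChoiceOfSample k' x₀) ∧
      ∀ x₀ : ℤ, FarZero.IsChoiceOfSample k' x₀ →
        (∃ roots : List ℝ, FarZero.ListsRoots g x₀ roots) ∧
        ∀ roots : List ℝ, FarZero.ListsRoots g x₀ roots →
          FarZero.MeetsSpec g k' (FarZero.output I roots) := by
  have hne := FarZero.boundPoly_ne_zero hsq hdeg hI
  refine ⟨FarZero.exists_isChoiceOfBound hne, fun k' hk' => ⟨exists_int_gt _, fun x₀ hx₀ =>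
    ⟨FarZero.exists_listsRoots (FarZero.factors_ne_zero_of_boundPoly
      (hk'.aeval_ne_zero hne hx₀.le)).1, fun roots hroots =>
      FarZero.meetsSpec_output hdeg hne hk' hx₀ hroots⟩⟩⟩
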